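/- Let $\mathbb K\in\{\mathbb R,\mathbb C\}$ and let $(\Omega,\Sigma,\mu)$ be a complete, strictly localizable measure space, i.e. $\Omega$ has a partition $\mathcal A$ into measurable sets of finite measure such that a set $B\subset\Omega$ is measurable as soon as $B\cap A$ is measurable for every $A\in\mathcal A$, and $\mu(B)=\sum_{A\in\mathcal A}\mu(B\cap A)$ for every measurable $B$. Let $F$ be a Banach space over $\mathbb K$ with dual $F'$, and let $p\in[1,\infty]$. If a Banach space $X$ is identified isometrically with the dual $G'$ of a Banach space $G$, let $\mathcal L_{\sigma^*}(\Omega;X)$ be the space of functions $f\colon\Omega\to X$ such that $\langle f(\cdot),u\rangle$ is measurable for all $u\in G$ and $\|f\|_{\sigma^*}:=\sup_{\|u\|_G\le 1}\operatorname{ess\,sup}_{\omega\in\Omega}|\langle f(\omega),u\rangle|<\infty$, and let $L^\infty_{\sigma^*}(\Omega;X)$ be its quotient by the functions with $\|f\|_{\sigma^*}=0$. The space $\mathscr L(F')$ of bounded linear operators on $F'$ is regarded as the dual of the projective tensor product $F'\tilde\otimes_\pi F$ via $\langle S,v'\otimes v\rangle=\langle Sv',v\rangle$. Let $T$ be a bounded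 linear operator on the Bochner space $L^p(\Omega;F')$ which is local, i.e. for every $f\in L^p(\Omega;F')$ one has $Tf=0$ almost everywhere on $\{\omega: f(\omega)=0\}$ (equivalently, $T(\mathbf 1_Af)=\mathbf 1_A\,Tf$ for all $f\in L^p(\Omega;F')$ and $A\in\Sigma$). Then there exists $M\in L^\infty_{\sigma^*}(\Omega;\mathscr L(F'))$ such that $T$ is the multiplication operator $\mathcal M_M$, $(\mathcal M_Mf)(\omega)=M(\omega)f(\omega)$, in the following sense: (a) for every representative $N$ of $M$, every $f\in L^p(\Omega;F')$ and every $v\in F$, $\langle N(\omega)f(\omega),v\rangle=\langle (Tf)(\omega),v\rangle$ for almost every $\omega\in\Omega$; (b) there is a representative $N$ of $M$ such that for every $f\in L^p(\Omega;F')$, $N(\omega)f(\omega)=(Tf)(\omega)$ for almost every $\omega\in\Omega$. -/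

import Mathlib

open MeasureTheory
open scoped ENNReal

set_option maxSynthPendingDepth 3

noncomputable section

/-- A measure space is strictly localizable (decomposable) if it has a partition into measurable
sets of finite measure that determines both the measurable sets and the measure. -/
def IsStrictlyLocalizable {Ω : Type*} [MeasurableSpace Ω] (μ : Measure Ω) : Prop :=
  ∃ 𝒜 : Set (Set Ω),
    (∀ A ∈ 𝒜, MeasurableSet A ∧ μ A < ∞) ∧
    𝒜.PairwiseDisjoint id ∧
    ⋃₀ 𝒜 = Set.univ ∧
    (∀ B : Set Ω, (∀ A ∈ 𝒜, MeasurableSet (B ∩ A)) → MeasurableSet B) ∧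
    (∀ B : Set Ω, MeasurableSet B → μ B = ∑' A : 𝒜, μ (B ∩ (A : Set Ω)))

section ProjectiveTensor

variable {𝕜 : Type*} [RCLike 𝕜]
variable {E : Type*} [NormedAddCommGroup E] [NormedSpace 𝕜 E]
variable {F : Type*} [NormedAddCommGroup F] [NormedSpace 𝕜 F]

/-- The elementary tensor `x ⊗ y`, acting on operators `S : E → F'` by `S ↦ ⟨S x, y⟩`. -/
def elemTensor (x : E) (y : F) : StrongDual 𝕜 (E →L[𝕜] StrongDual 𝕜 F) :=
  (ContinuousLinearMap.apply 𝕜 𝕜 y).comp (ContinuousLinearMap.apply 𝕜 (StrongDual 𝕜 F) x)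

@[simp] lemma elemTensor_apply (x : E) (y : F) (S : E →L[𝕜] StrongDual 𝕜 F) :
    elemTensor x y S = S x y := rfl

lemma norm_elemTensor_le (x : E) (y : F) : ‖elemTensor (𝕜 := 𝕜) x y‖ ≤ ‖x‖ * ‖y‖ := by
  refine ContinuousLinearMap.opNorm_le_bound _ (by positivity) fun S => ?_
  calc ‖S x y‖ ≤ ‖S x‖ * ‖y‖ := (S x).le_opNorm y
    _ ≤ (‖S‖ * ‖x‖) * ‖y‖ := by gcongr; exact S.le_opNorm x
    _ = ‖x‖ * ‖y‖ * ‖S‖ := by ring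

variable (𝕜 E F) in
/-- The linear span of the elementary tensors in the dual of `L(E, F')`. -/
def elemTensorSpan : Submodule 𝕜 (StrongDual 𝕜 (E →L[𝕜] StrongDual 𝕜 F)) :=
  Submodule.span 𝕜 {t | ∃ (x : E) (y : F), elemTensor (𝕜 := 𝕜) x y = t}

variable (𝕜 E F) in
/-- The (completed) projective tensor product of `E` and `F`, realized as the closed linear span of
the elementary tensors in the dual of `L(E, F')`, with the induced norm. -/
def ProjTensor : Type _ := (elemTensorSpan 𝕜 E F).topologicalClosure

namespace ProjTensor

instance : NormedAddCommGroup (ProjTensor 𝕜 E F) :=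
  inferInstanceAs (NormedAddCommGroup (elemTensorSpan 𝕜 E F).topologicalClosure)

instance : NormedSpace 𝕜 (ProjTensor 𝕜 E F) :=
  inferInstanceAs (NormedSpace 𝕜 (elemTensorSpan 𝕜 E F).topologicalClosure)

instance : CompleteSpace (ProjTensor 𝕜 E F) :=
  inferInstanceAs (CompleteSpace (elemTensorSpan 𝕜 E F).topologicalClosure)

variable (𝕜 E F) in
/-- The inclusion of the projective tensor product into the dual of `L(E, F')`. -/
def incl : ProjTensor 𝕜 E F →ₗᵢ[𝕜] StrongDual 𝕜 (E →L[𝕜] StrongDual 𝕜 F) :=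
  (elemTensorSpan 𝕜 E F).topologicalClosure.subtypeₗᵢ

/-- The elementary tensor `x ⊗ y` as an element of the projective tensor product. -/
def tmul (x : E) (y : F) : ProjTensor 𝕜 E F :=
  ⟨elemTensor x y, Submodule.le_topologicalClosure _ (Submodule.subset_span ⟨x, y, rfl⟩)⟩

@[simp] lemma incl_tmul (x : E) (y : F) (S : E →L[𝕜] StrongDual 𝕜 F) :
    incl 𝕜 E F (tmul x y) S = S x y := rfl

lemma norm_tmul_le (x : E) (y : F) : ‖(tmul x y : ProjTensor 𝕜 E F)‖ ≤ ‖x‖ * ‖y‖ :=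
  norm_elemTensor_le x y

lemma ext_incl {u w : ProjTensor 𝕜 E F} (h : ∀ S, incl 𝕜 E F u S = incl 𝕜 E F w S) : u = w :=
  (incl 𝕜 E F).injective (ContinuousLinearMap.ext h)

lemma tmul_add_left (x x' : E) (y : F) :
    (tmul (x + x') y : ProjTensor 𝕜 E F) = tmul x y + tmul x' y :=
  ext_incl fun S => by simp

lemma tmul_add_right (x : E) (y y' : F) :
    (tmul x (y + y') : ProjTensor 𝕜 E F) = tmul x y + tmul x y' :=
  ext_incl fun S => by simp

lemma tmul_smul_left (c : 𝕜) (x : E) (y : F) :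
    (tmul (c • x) y : ProjTensor 𝕜 E F) = c • tmul x y :=
  ext_incl fun S => by simp

lemma tmul_smul_right (c : 𝕜) (x : E) (y : F) :
    (tmul x (c • y) : ProjTensor 𝕜 E F) = c • tmul x y :=
  ext_incl fun S => by simp

/-- Two functionals on the projective tensor product agree if they agree on elementary tensors. -/
lemma dual_ext {φ ψ : StrongDual 𝕜 (ProjTensor 𝕜 E F)}
    (h : ∀ (x : E) (y : F), φ (tmul x y) = ψ (tmul x y)) : φ = ψ := by
  have key : ∀ u (hu : u ∈ elemTensorSpan 𝕜 E F),
      φ (show ProjTensor 𝕜 E F from ⟨u, Submodule.le_topologicalClosure _ hu⟩) =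
        ψ (show ProjTensor 𝕜 E F from ⟨u, Submodule.le_topologicalClosure _ hu⟩) := by
    intro u hu
    induction hu using Submodule.span_induction with
    | mem t ht => obtain ⟨x, y, rfl⟩ := ht; exact h x y
    | zero => exact (map_zero φ).trans (map_zero ψ).symm
    | add a b ha hb iha ihb =>
      exact (map_add φ _ _).trans ((congrArg₂ (· + ·) iha ihb).trans (map_add ψ _ _).symm)
    | smul c a ha iha =>
      exact (map_smul φ c _).trans ((congrArg (c • ·) iha).trans (map_smul ψ c _).symm)
  ext u
  obtain ⟨u, hu⟩ := u
  obtain ⟨s, hs, hlim⟩ := mem_closure_iff_seq_limit.1 hu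
  have hlim' : Filter.Tendsto
      (fun n => (show ProjTensor 𝕜 E F from ⟨s n, Submodule.le_topologicalClosure _ (hs n)⟩))
      Filter.atTop (nhds (show ProjTensor 𝕜 E F from ⟨u, hu⟩)) :=
    tendsto_subtype_rng.2 hlim
  refine tendsto_nhds_unique ((φ.continuous.tendsto _).comp hlim') ?_
  refine ((ψ.continuous.tendsto _).comp hlim').congr fun n => ?_
  exact (key (s n) (hs n)).symm

/-- An operator `S : E → F'` as a functional on the projective tensor product. -/
def toDual (S : E →L[𝕜] StrongDual 𝕜 F) : StrongDual 𝕜 (ProjTensor 𝕜 E F) :=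
  (ContinuousLinearMap.apply 𝕜 𝕜 S).comp (incl 𝕜 E F).toContinuousLinearMap

lemma toDual_apply (S : E →L[𝕜] StrongDual 𝕜 F) (u : ProjTensor 𝕜 E F) :
    toDual S u = incl 𝕜 E F u S := rfl

lemma norm_toDual (S : E →L[𝕜] StrongDual 𝕜 F) : ‖toDual S‖ = ‖S‖ := by
  refine le_antisymm ?_ ?_
  · refine ContinuousLinearMap.opNorm_le_bound _ (norm_nonneg _) fun u => ?_
    calc ‖incl 𝕜 E F u S‖ ≤ ‖incl 𝕜 E F u‖ * ‖S‖ := ContinuousLinearMap.le_opNorm _ _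
      _ = ‖S‖ * ‖u‖ := by rw [mul_comm, LinearIsometry.norm_map]
  · refine ContinuousLinearMap.opNorm_le_bound _ (norm_nonneg _) fun x => ?_
    refine ContinuousLinearMap.opNorm_le_bound _ (by positivity) fun y => ?_
    calc ‖S x y‖ = ‖toDual S (tmul x y)‖ := rfl
      _ ≤ ‖toDual S‖ * ‖(tmul x y : ProjTensor 𝕜 E F)‖ := ContinuousLinearMap.le_opNorm _ _
      _ ≤ ‖toDual S‖ * (‖x‖ * ‖y‖) := by gcongr; exact norm_tmul_le x y
      _ = ‖toDual S‖ * ‖x‖ * ‖y‖ := by ring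

lemma toDual_surjective (φ : StrongDual 𝕜 (ProjTensor 𝕜 E F)) :
    ∃ S : E →L[𝕜] StrongDual 𝕜 F, toDual S = φ := by
  refine ⟨LinearMap.mkContinuous₂
    (LinearMap.mk₂ 𝕜 (fun x y => φ (tmul x y))
      (fun x x' y => by rw [tmul_add_left, map_add])
      (fun c x y => by rw [tmul_smul_left, map_smul])
      (fun x y y' => by rw [tmul_add_right, map_add])
      (fun c x y => by rw [tmul_smul_right, map_smul]))
    ‖φ‖ (fun x y => ?_), dual_ext fun x y => rfl⟩
  calc ‖φ (tmul x y)‖ ≤ ‖φ‖ * ‖(tmul x y : ProjTensor 𝕜 E F)‖ := φ.le_opNorm _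
    _ ≤ ‖φ‖ * (‖x‖ * ‖y‖) := by gcongr; exact norm_tmul_le x y
    _ = ‖φ‖ * ‖x‖ * ‖y‖ := by ring

variable (𝕜 E F) in
/-- The canonical isometric isomorphism of `L(E, F')` with the dual of the projective tensor product
of `E` and `F`, given by `⟨S, x ⊗ y⟩ = ⟨S x, y⟩`. -/
def dualEquiv : (E →L[𝕜] StrongDual 𝕜 F) ≃ₗᵢ[𝕜] StrongDual 𝕜 (ProjTensor 𝕜 E F) :=
  LinearIsometryEquiv.ofSurjective
    { toFun := toDual
      map_add' := fun S S' => by ext u; simp [toDual_apply]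
      map_smul' := fun c S => by ext u; simp [toDual_apply]
      norm_map' := norm_toDual }
    toDual_surjective

lemma dualEquiv_tmul (S : E →L[𝕜] StrongDual 𝕜 F) (x : E) (y : F) :
    dualEquiv 𝕜 E F S (tmul x y) = S x y := rfl

end ProjTensor

end ProjectiveTensor

section SigmaStar

/-! Throughout, `X` is a Banach space with a chosen predual `G`, i.e. an isometric
identification `J` of `X` with `G'`. -/

variable {𝕜 : Type*} [RCLike 𝕜]
variable {X : Type*} [NormedAddCommGroup X] [NormedSpace 𝕜 X]
variable {G : Type*} [NormedAddCommGroup G] [NormedSpace 𝕜 G]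
variable {Ω : Type*} [MeasurableSpace Ω]

/-- `sup_{v ∈ B_G} ess sup_ω |⟨f(ω), v⟩|`, as an extended nonnegative number. -/
def sigmaStarNorm (J : X ≃ₗᵢ[𝕜] StrongDual 𝕜 G) (μ : Measure Ω) (f : Ω → X) : ℝ≥0∞ :=
  ⨆ v ∈ Metric.closedBall (0 : G) 1, essSup (fun ω => ‖J (f ω) v‖ₑ) μ

lemma sigmaStarNorm_zero (J : X ≃ₗᵢ[𝕜] StrongDual 𝕜 G) (μ : Measure Ω) :
    sigmaStarNorm J μ (0 : Ω → X) = 0 := by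
  simp only [sigmaStarNorm, Pi.zero_apply, map_zero, zero_apply, enorm_zero,
    ENNReal.iSup_eq_zero]
  intro v _
  exact le_antisymm (essSup_le_of_ae_le 0 (Filter.Eventually.of_forall fun _ => le_rfl)) bot_le

lemma sigmaStarNorm_add_le (J : X ≃ₗᵢ[𝕜] StrongDual 𝕜 G) (μ : Measure Ω) (f g : Ω → X) :
    sigmaStarNorm J μ (f + g) ≤ sigmaStarNorm J μ f + sigmaStarNorm J μ g := by
  refine iSup₂_le fun v hv => ?_
  calc essSup (fun ω => ‖J ((f + g) ω) v‖ₑ) μ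
      ≤ essSup ((fun ω => ‖J (f ω) v‖ₑ) + fun ω => ‖J (g ω) v‖ₑ) μ := by
        refine essSup_mono_ae (Filter.Eventually.of_forall fun ω => ?_)
        simpa using enorm_add_le (J (f ω) v) (J (g ω) v)
    _ ≤ essSup (fun ω => ‖J (f ω) v‖ₑ) μ + essSup (fun ω => ‖J (g ω) v‖ₑ) μ :=
        ENNReal.essSup_add_le _ _
    _ ≤ _ := add_le_add (le_iSup₂ (f := fun v _ => essSup (fun ω => ‖J (f ω) v‖ₑ) μ) v hv)
        (le_iSup₂ (f := fun v _ => essSup (fun ω => ‖J (g ω) v‖ₑ) μ) v hv)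

lemma sigmaStarNorm_smul_le (J : X ≃ₗᵢ[𝕜] StrongDual 𝕜 G) (μ : Measure Ω) (c : 𝕜) (f : Ω → X) :
    sigmaStarNorm J μ (c • f) ≤ ‖c‖ₑ * sigmaStarNorm J μ f := by
  refine iSup₂_le fun v hv => ?_
  calc essSup (fun ω => ‖J ((c • f) ω) v‖ₑ) μ
      = essSup (fun ω => ‖c‖ₑ * ‖J (f ω) v‖ₑ) μ := by simp
    _ = ‖c‖ₑ * essSup (fun ω => ‖J (f ω) v‖ₑ) μ := ENNReal.essSup_const_mul
    _ ≤ _ := by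
        gcongr
        exact le_iSup₂ (f := fun v _ => essSup (fun ω => ‖J (f ω) v‖ₑ) μ) v hv

/-- The space of `σ(X, G)`-measurable, `σ(X, G)`-bounded functions from `Ω` to `X`. -/
def LSigmaStarFun (J : X ≃ₗᵢ[𝕜] StrongDual 𝕜 G) (μ : Measure Ω) : Submodule 𝕜 (Ω → X) where
  carrier := {f | (∀ v : G, Measurable fun ω => J (f ω) v) ∧ sigmaStarNorm J μ f < ∞}
  zero_mem' := ⟨fun v => by simp, by simp [sigmaStarNorm_zero]⟩
  add_mem' := fun {f g} hf hg =>
    ⟨fun v => by simpa using! (hf.1 v).add (hg.1 v),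
      (sigmaStarNorm_add_le J μ f g).trans_lt (ENNReal.add_lt_top.2 ⟨hf.2, hg.2⟩)⟩
  smul_mem' := fun c f hf =>
    ⟨fun v => by simpa using (hf.1 v).const_mul c,
      (sigmaStarNorm_smul_le J μ c f).trans_lt (ENNReal.mul_lt_top (by simp) hf.2)⟩

/-- The functions of vanishing `σ*`-seminorm. -/
def LSigmaStarNull (J : X ≃ₗᵢ[𝕜] StrongDual 𝕜 G) (μ : Measure Ω) :
    Submodule 𝕜 (LSigmaStarFun J μ) where
  carrier := {f | sigmaStarNorm J μ (f : Ω → X) = 0}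
  zero_mem' := sigmaStarNorm_zero J μ
  add_mem' := fun {f g} hf hg => le_antisymm
    ((sigmaStarNorm_add_le J μ f g).trans (by rw [hf, hg, add_zero])) bot_le
  smul_mem' := fun c f hf => le_antisymm
    ((sigmaStarNorm_smul_le J μ c f).trans (by rw [hf, mul_zero])) bot_le

/-- `L^∞_{σ*}(Ω; X)`: functions modulo those of vanishing `σ*`-seminorm. -/
abbrev LInftySigmaStar (J : X ≃ₗᵢ[𝕜] StrongDual 𝕜 G) (μ : Measure Ω) : Type _ :=
  LSigmaStarFun J μ ⧸ LSigmaStarNull J μ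

end SigmaStar

section Multipliers

variable {𝕜 : Type*} [RCLike 𝕜]
variable {Ω : Type*} [MeasurableSpace Ω]

/-- An operator on `L^p(Ω; E)` is local if `T f = 0` almost everywhere on `{f = 0}`. -/
def IsLocalOperator {E : Type*} [NormedAddCommGroup E] [NormedSpace 𝕜 E] {μ : Measure Ω}
    {p : ℝ≥0∞} [Fact (1 ≤ p)] (T : Lp E p μ →L[𝕜] Lp E p μ) : Prop :=
  ∀ f : Lp E p μ, ∀ᵐ ω ∂μ, f ω = 0 → T f ω = 0

variable (𝕜) in
/-- The multipliers `L^∞_{σ*}(Ω; L(F'))`, where `L(F')` is regarded as the dual of the projective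
tensor product of `F'` and `F`. -/
abbrev Multipliers (F : Type*) [NormedAddCommGroup F] [NormedSpace 𝕜 F] (μ : Measure Ω) : Type _ :=
  LInftySigmaStar (ProjTensor.dualEquiv 𝕜 (StrongDual 𝕜 F) F) μ

/-- `T` is the multiplication operator with multiplier `M`, i.e. `(T f)(ω) = M(ω) f(ω)`.
For an arbitrary representative `N` of the class `M`, the function `ω ↦ N(ω) f(ω)` is determined
only up to weak-* equivalence, and in this sense it is required to coincide with `T f`
(`weak`). For a suitable representative it is required to coincide with `T f`
almost everywhere, for all `f` (`strong`). -/
structure IsMultiplicationBy {F : Type*} [NormedAddCommGroup F] [NormedSpace 𝕜 F]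
    {μ : Measure Ω} {p : ℝ≥0∞} [Fact (1 ≤ p)] (M : Multipliers 𝕜 F μ)
    (T : Lp (StrongDual 𝕜 F) p μ →L[𝕜] Lp (StrongDual 𝕜 F) p μ) : Prop where
  weak : ∀ N : LSigmaStarFun (ProjTensor.dualEquiv 𝕜 (StrongDual 𝕜 F) F) μ,
    Submodule.Quotient.mk N = M →
      ∀ (f : Lp (StrongDual 𝕜 F) p μ) (v : F),
        ∀ᵐ ω ∂μ, (N : Ω → StrongDual 𝕜 F →L[𝕜] StrongDual 𝕜 F) ω (f ω) v = T f ω v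
  strong : ∃ N : LSigmaStarFun (ProjTensor.dualEquiv 𝕜 (StrongDual 𝕜 F) F) μ,
    Submodule.Quotient.mk N = M ∧
      ∀ f : Lp (StrongDual 𝕜 F) p μ,
        ∀ᵐ ω ∂μ, (N : Ω → StrongDual 𝕜 F →L[𝕜] StrongDual 𝕜 F) ω (f ω) = T f ω

end Multipliers

end

/-! Locality turns the norm bound of `T` into a pointwise one: on a set of finite measure where `‖f‖
≤ c`, also `‖T f‖ ≤ ‖T‖ * c` almost everywhere (`IsLocalOperator.norm_le`). On a cell `A` one wants
to set `N(ω)x = T(1_A x)(ω)`, but linearity and boundedness in `x` hold only outside null sets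
depending on `x`, and the dual of `F` need not be separable.

The remedy is a lower density (`DensitySystem.exists_filter`): proper filters `f ω ≤ ae μ` such that
every measurable `B` belongs to `f ω` for almost every `ω ∈ B`. Along an ultrafilter finer than `f
ω`, almost everywhere identities hold eventually, for every `ω`. So the weak-* limits of `T(1_A x)`
along it form an operator `N(ω)` of norm at most `‖T‖`, by compactness of balls in the scalars
(`exists_weakStar_limit`). A strongly measurable function has separable range, so its limit gives
back its value almost everywhere (`ae_eq_of_tendsto_apply`); hence `N(ω)x = T(1_A x)(ω)` for almost
every `ω ∈ A`.

The cells are glued by strict localizability and completeness. Separability of the range of `f` and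
the local bound extend the identity from constants to all `f` (`IsLocalOperator.ae_eq_of_const`). -/

noncomputable section

/-! ### Existence of lower densities on finite measure spaces, by Zorn's lemma. -/

section DensitySystems

open Filter Set Topology

/-- A lower density on a sub-σ-algebra `σ`, encoded by the filters `filter ω` of the sets of which
`ω` is a density point. -/
structure DensitySystem {Ω : Type*} {mΩ : MeasurableSpace Ω} (μ : Measure Ω) where
  σ : MeasurableSpace Ω
  le : σ ≤ mΩ
  filter : Ω → Filter Ω
  neBot : ∀ ω, (filter ω).NeBot
  le_ae : ∀ ω, filter ω ≤ ae μ
  exists_measurable : ∀ ω, ∀ S ∈ filter ω, ∃ B, MeasurableSet[σ] B ∧ B ∈ filter ω ∧ B ≤ᵐ[μ] S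
  ae_mem : ∀ B, MeasurableSet[σ] B → ∀ᵐ ω ∂μ, ω ∈ B → B ∈ filter ω

namespace DensitySystem

variable {Ω : Type*} {mΩ : MeasurableSpace Ω} {μ : Measure Ω}

/-- Going up enlarges the σ-algebra and refines the filters. Since any measurable set can be
adjoined, a maximal system has the full σ-algebra. -/
instance : Preorder (DensitySystem μ) where
  le D D' := D.σ ≤ D'.σ ∧ ∀ ω, D'.filter ω ≤ D.filter ω
  le_refl D := ⟨le_rfl, fun _ => le_rfl⟩
  le_trans _ _ _ h h' := ⟨h.1.trans h'.1, fun ω => (h'.2 ω).trans (h.2 ω)⟩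

lemma mem_of_ae_le (D : DensitySystem μ) {ω : Ω} {A B : Set Ω} (hA : A ∈ D.filter ω)
    (h : A ≤ᵐ[μ] B) : B ∈ D.filter ω := by
  filter_upwards [hA, D.le_ae ω h] with x hx hx' using hx' hx

/-- The trivial density system, on the trivial σ-algebra. -/
def trivial [NeZero μ] : DensitySystem μ where
  σ := ⊥
  le := bot_le
  filter _ := ae μ
  neBot _ := inferInstance
  le_ae _ := le_rfl
  exists_measurable _ S hS := ⟨univ, MeasurableSet.univ, univ_mem, by
    filter_upwards [hS] with x hx _ using hx⟩
  ae_mem B hB := by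
    rcases MeasurableSpace.measurableSet_bot_iff.1 hB with rfl | rfl <;> simp

/-- The σ-algebra generated by `m` and one more set `E`. -/
@[reducible] def adjoinSet (m : MeasurableSpace Ω) (E : Set Ω) : MeasurableSpace Ω where
  MeasurableSet' S := ∃ A B, MeasurableSet[m] A ∧ MeasurableSet[m] B ∧ S = E.ite A B
  measurableSet_empty := ⟨∅, ∅, MeasurableSet.empty, MeasurableSet.empty, by simp⟩
  measurableSet_compl := by
    rintro _ ⟨A, B, hA, hB, rfl⟩
    refine ⟨Aᶜ, Bᶜ, hA.compl, hB.compl, ?_⟩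
    ext x; by_cases hx : x ∈ E <;> simp [Set.ite, hx]
  measurableSet_iUnion := by
    intro f hf
    choose A B hA hB h using hf
    refine ⟨⋃ i, A i, ⋃ i, B i, MeasurableSet.iUnion hA, MeasurableSet.iUnion hB, ?_⟩
    ext x; by_cases hx : x ∈ E <;> simp [Set.ite, hx, h]

lemma le_adjoinSet (m : MeasurableSpace Ω) (E : Set Ω) : m ≤ adjoinSet m E :=
  fun A hA => ⟨A, A, hA, hA, by simp⟩

lemma measurableSet_adjoinSet_self (m : MeasurableSpace Ω) (E : Set Ω) :
    MeasurableSet[adjoinSet m E] E :=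
  ⟨univ, ∅, MeasurableSet.univ, MeasurableSet.empty, by simp [Set.ite]⟩

lemma adjoinSet_le {m : MeasurableSpace Ω} (h : m ≤ mΩ) {E : Set Ω} (hE : MeasurableSet[mΩ] E) :
    adjoinSet m E ≤ mΩ := by
  rintro _ ⟨A, B, hA, hB, rfl⟩
  exact hE.ite (h _ hA) (h _ hB)

/-- The conditional probability of `B` given `m`. -/
abbrev condProb (μ : Measure Ω) (m : MeasurableSpace Ω) (B : Set Ω) : Ω → ℝ :=
  μ[B.indicator (fun _ => (1 : ℝ)) | m]

lemma integrable_indicator_one [IsFiniteMeasure μ] {B : Set Ω} (hB : MeasurableSet[mΩ] B) :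
    Integrable (B.indicator fun _ => (1 : ℝ)) μ :=
  (integrable_const 1).indicator hB

lemma condProb_mono [IsFiniteMeasure μ] (m : MeasurableSpace Ω) {A B : Set Ω}
    (hA : MeasurableSet[mΩ] A) (hB : MeasurableSet[mΩ] B) (h : A ≤ᵐ[μ] B) :
    condProb μ m A ≤ᵐ[μ] condProb μ m B := by
  refine condExp_mono (integrable_indicator_one hA) (integrable_indicator_one hB) ?_
  filter_upwards [h] with x hx
  by_cases hA : x ∈ A
  · have hB : x ∈ B := hx hA
    simp [hA, hB]
  · simp only [hA, not_false_eq_true, indicator_of_notMem]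
    exact indicator_nonneg (by simp) _

lemma condProb_of_measurableSet [IsFiniteMeasure μ] {m : MeasurableSpace Ω} (hm : m ≤ mΩ)
    {B : Set Ω} (hB : MeasurableSet[m] B) :
    condProb μ m B = B.indicator fun _ => (1 : ℝ) :=
  condExp_of_stronglyMeasurable hm (stronglyMeasurable_const.indicator hB)
    (integrable_indicator_one (hm _ hB))

lemma condProb_inter [IsFiniteMeasure μ] (m : MeasurableSpace Ω) {A B : Set Ω}
    (hA : MeasurableSet[mΩ] A) (hB : MeasurableSet[mΩ] B) (hm : m ≤ mΩ) :
    condProb μ m A + condProb μ m B - 1 ≤ᵐ[μ] condProb μ m (A ∩ B) := by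
  have hA' := integrable_indicator_one (μ := μ) hA
  have hB' := integrable_indicator_one (μ := μ) hB
  have h1 : μ[(fun _ => (1 : ℝ)) | m] = fun _ => 1 := condExp_const hm 1
  have := condExp_mono (m := m) (μ := μ) ((hA'.add hB').sub (integrable_const (1 : ℝ)))
    (integrable_indicator_one (hA.inter hB)) (Eventually.of_forall fun x => by
      by_cases hxA : x ∈ A <;> by_cases hxB : x ∈ B <;> simp [hxA, hxB])
  filter_upwards [this, condExp_sub (hA'.add hB') (integrable_const (1 : ℝ)) m,
    condExp_add hA' hB' m] with x hx h2 h3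
  rw [h2] at hx
  simp only [Pi.sub_apply, Pi.add_apply] at hx h3 ⊢
  rw [h3, h1] at hx
  exact hx

lemma condProb_eq_zero_of_disjoint [IsFiniteMeasure μ] {m : MeasurableSpace Ω}
    {B E : Set Ω} (hB : MeasurableSet[m] B) (hE : MeasurableSet[mΩ] E) (h : B ≤ᵐ[μ] (Eᶜ : Set Ω)) :
    ∀ᵐ x ∂μ, x ∈ B → condProb μ m E x = 0 := by
  have h0 : B.indicator (E.indicator fun _ => (1 : ℝ)) =ᵐ[μ] 0 := by
    filter_upwards [h] with x hx
    by_cases hxB : x ∈ B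
    · have : x ∉ E := hx hxB
      simp [this]
    · simp [hxB]
  have h1 := condExp_congr_ae (m := m) h0
  filter_upwards [h1, condExp_indicator (integrable_indicator_one hE) hB] with x hx h2 hxB
  rw [h2, condExp_zero] at hx
  simpa [hxB] using hx

/-- On the set where the conditional probability is not positive, its integral is both nonpositive
and equal to the measure of the part of `E` inside that set. -/
lemma ae_condProb_pos [IsFiniteMeasure μ] {m : MeasurableSpace Ω} (hm : m ≤ mΩ)
    {E : Set Ω} (hE : MeasurableSet[mΩ] E) : ∀ᵐ x ∂μ, x ∈ E → 0 < condProb μ m E x := by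
  set W : Set Ω := {x | 0 < condProb μ m E x}
  have hW : MeasurableSet[m] W := stronglyMeasurable_condExp.measurable measurableSet_Ioi
  have h1 := setIntegral_condExp hm (integrable_indicator_one (μ := μ) hE) hW.compl
  have h2 : ∫ x in Wᶜ, condProb μ m E x ∂μ ≤ 0 :=
    setIntegral_nonpos (hm _ hW.compl) fun x hx => not_lt.1 hx
  rw [h1, integral_indicator hE, Measure.restrict_restrict hE] at h2
  simp only [integral_const, MeasurableSet.univ, measureReal_restrict_apply, univ_inter,
    smul_eq_mul, mul_one] at h2
  have h3 : μ (E ∩ Wᶜ) = 0 := by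
    rw [← measureReal_eq_zero_iff]
    exact le_antisymm h2 measureReal_nonneg
  filter_upwards [measure_eq_zero_iff_ae_notMem.1 h3] with x hx hxE
  by_contra hW
  exact hx ⟨hxE, hW⟩

/-- The set `W` where `E` has positive conditional probability contains almost all of `E`, so it
lies in the filter at almost every point of `E`. A member of that filter missing `E` would
essentially contain a `D.σ`-measurable member `B` missing `E`; then `W ∩ B` is null, yet it lies in
a proper filter below `ae μ`. The exceptional null set does not depend on the member. -/
lemma ae_neBot_inf [IsFiniteMeasure μ] (D : DensitySystem μ) {E : Set Ω} (hE : MeasurableSet[mΩ] E) :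
    ∀ᵐ ω ∂μ, ω ∈ E → (D.filter ω ⊓ 𝓟 E).NeBot := by
  have hW : MeasurableSet[D.σ] {x | 0 < condProb μ D.σ E x} :=
    stronglyMeasurable_condExp.measurable measurableSet_Ioi
  filter_upwards [ae_condProb_pos D.le hE, D.ae_mem _ hW] with ω h1 h2 hω
  have hWω := h2 (h1 hω)
  have := D.neBot ω
  rw [inf_principal_neBot_iff]
  intro S hS
  obtain ⟨B, hB, hBω, hBS⟩ := D.exists_measurable ω S hS
  by_contra hne
  rw [not_nonempty_iff_eq_empty] at hne
  have hBE : B ≤ᵐ[μ] (Eᶜ : Set Ω) := by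
    filter_upwards [hBS] with x hx hxB hxE
    exact (hne ▸ (⟨hx hxB, hxE⟩ : x ∈ S ∩ E) : x ∈ (∅ : Set Ω))
  obtain ⟨x, hx⟩ := ((inter_mem hWω hBω)
    |> inter_mem (D.le_ae ω (condProb_eq_zero_of_disjoint hB hE hBE)) |>
      (D.neBot ω).nonempty_of_mem)
  exact (hx.2.1 : 0 < condProb μ D.σ E x).ne' (hx.1 hx.2.2)

open Classical in
/-- The filters of the density system extended by the set `E`. -/
def adjoinFilter (f : Filter Ω) (E : Set Ω) (ω : Ω) : Filter Ω :=
  if ω ∈ E ∧ (f ⊓ 𝓟 E).NeBot then f ⊓ 𝓟 E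
  else if ω ∉ E ∧ (f ⊓ 𝓟 Eᶜ).NeBot then f ⊓ 𝓟 Eᶜ else f

lemma adjoinFilter_le (f : Filter Ω) (E : Set Ω) (ω : Ω) : adjoinFilter f E ω ≤ f := by
  unfold adjoinFilter
  split_ifs
  · exact inf_le_left
  · exact inf_le_left
  · exact le_rfl

/-- Each filter is cut down to `E` or to its complement, whichever contains `ω`. Where this trace is
improper the old filter is kept, so the axioms demanded at every `ω` survive; by `ae_neBot_inf` this
happens only on a null set, which `ae_mem` tolerates. -/
lemma exists_adjoin [IsFiniteMeasure μ] (D : DensitySystem μ) {E : Set Ω} (hE : MeasurableSet[mΩ] E) :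
    ∃ D' : DensitySystem μ, D ≤ D' ∧ MeasurableSet[D'.σ] E := by
  have key : ∀ (E' : Set Ω), MeasurableSet[adjoinSet D.σ E] E' → ∀ ω,
      ∀ S ∈ D.filter ω ⊓ 𝓟 E', ∃ B, MeasurableSet[adjoinSet D.σ E] B ∧
        B ∈ D.filter ω ⊓ 𝓟 E' ∧ B ≤ᵐ[μ] S := by
    intro E' hE' ω S hS
    obtain ⟨B, hB, hBω, hBS⟩ := D.exists_measurable ω _ (mem_inf_principal.1 hS)
    refine ⟨B ∩ E', (le_adjoinSet _ _ _ hB).inter hE',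
      inter_mem (mem_inf_of_left hBω) (mem_inf_of_right (mem_principal_self _)), ?_⟩
    filter_upwards [hBS] with x hx hx'
    exact hx hx'.1 hx'.2
  have hE0 := measurableSet_adjoinSet_self D.σ E
  refine ⟨⟨adjoinSet D.σ E, adjoinSet_le D.le hE, fun ω => adjoinFilter (D.filter ω) E ω, ?_,
    fun ω => (adjoinFilter_le _ _ _).trans (D.le_ae ω), ?_, ?_⟩,
    ⟨le_adjoinSet _ _, fun ω => adjoinFilter_le _ _ _⟩, hE0⟩
  · intro ω
    unfold adjoinFilter
    split_ifs with h h'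
    · exact h.2
    · exact h'.2
    · exact D.neBot ω
  · intro ω S hS
    unfold adjoinFilter at hS ⊢
    split_ifs at hS ⊢ with h h'
    · exact key E hE0 ω S hS
    · exact key Eᶜ hE0.compl ω S hS
    · obtain ⟨B, hB, hBω, hBS⟩ := D.exists_measurable ω S hS
      exact ⟨B, le_adjoinSet _ _ _ hB, hBω, hBS⟩
  · rintro _ ⟨A, B, hA, hB, rfl⟩
    filter_upwards [D.ae_mem A hA, D.ae_mem B hB, D.ae_neBot_inf hE, D.ae_neBot_inf hE.compl]
      with ω hωA hωB h1 h2 hω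
    by_cases hωE : ω ∈ E
    · have hωA' : A ∈ D.filter ω := hωA (by simpa [Set.ite, hωE] using hω)
      simp only [adjoinFilter, hωE, h1 hωE, and_self, if_true]
      rw [mem_inf_principal]
      filter_upwards [hωA'] with x hx hxE
      exact Or.inl ⟨hx, hxE⟩
    · have hωB' : B ∈ D.filter ω := hωB (by simpa [Set.ite, hωE] using hω)
      simp only [adjoinFilter, hωE, h2 hωE, false_and, not_false_eq_true, and_self, if_true,
        if_false]
      rw [mem_inf_principal]
      filter_upwards [hωB'] with x hx hxE
      exact Or.inr ⟨hx, hxE⟩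

/-! ### Upper bounds of increasing sequences, by martingale convergence. -/

/-- `ω` is an asymptotic density point of `B` along a sequence of density systems. -/
def IsLimitDensityPoint (D : ℕ → DensitySystem μ) (B : Set Ω) (ω : Ω) : Prop :=
  ∀ ε > (0 : ℝ), ∀ᶠ k in atTop, {x | 1 - ε < condProb μ (D k).σ B x} ∈ (D k).filter ω

lemma IsLimitDensityPoint.mono [IsFiniteMeasure μ] {D : ℕ → DensitySystem μ} {A B : Set Ω} {ω : Ω}
    (h : IsLimitDensityPoint D A ω) (hA : MeasurableSet[mΩ] A) (hB : MeasurableSet[mΩ] B)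
    (hAB : A ≤ᵐ[μ] B) : IsLimitDensityPoint D B ω := by
  intro ε hε
  filter_upwards [h ε hε] with k hk
  refine (D k).mem_of_ae_le hk ?_
  filter_upwards [condProb_mono (D k).σ hA hB hAB] with x hx hx'
  exact lt_of_lt_of_le hx' hx

lemma IsLimitDensityPoint.inter [IsFiniteMeasure μ] {D : ℕ → DensitySystem μ} {A B : Set Ω}
    {ω : Ω} (h : IsLimitDensityPoint D A ω) (h' : IsLimitDensityPoint D B ω)
    (hA : MeasurableSet[mΩ] A) (hB : MeasurableSet[mΩ] B) : IsLimitDensityPoint D (A ∩ B) ω := by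
  intro ε hε
  filter_upwards [h (ε / 2) (half_pos hε), h' (ε / 2) (half_pos hε)] with k hk hk'
  refine (D k).mem_of_ae_le (inter_mem hk hk') ?_
  filter_upwards [condProb_inter (μ := μ) (D k).σ hA hB (D k).le] with x hx hx'
  have h1 : 1 - ε / 2 < condProb μ (D k).σ A x := hx'.1
  have h2 : 1 - ε / 2 < condProb μ (D k).σ B x := hx'.2
  simp only [Pi.sub_apply, Pi.add_apply, Pi.one_apply] at hx
  change 1 - ε < condProb μ (D k).σ (A ∩ B) x
  linarith

/-- From index `n` on, the conditional probability of `B` is its indicator. -/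
lemma isLimitDensityPoint_of_mem [IsFiniteMeasure μ] {D : ℕ → DensitySystem μ} (hD : Monotone D)
    {n : ℕ} {B : Set Ω} (hB : MeasurableSet[(D n).σ] B) {ω : Ω} (hω : B ∈ (D n).filter ω) :
    IsLimitDensityPoint D B ω := by
  intro ε hε
  filter_upwards [eventually_ge_atTop n] with k hk
  rw [condProb_of_measurableSet (D k).le ((hD hk).1 _ hB)]
  filter_upwards [(hD hk).2 ω hω] with x hx
  simp [hx, hε]

lemma not_isLimitDensityPoint_empty {D : ℕ → DensitySystem μ} {ω : Ω} :
    ¬ IsLimitDensityPoint D ∅ ω := by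
  intro h
  obtain ⟨k, hk⟩ := (h (1 / 2) (by norm_num)).exists
  have := (D k).neBot ω
  refine this.ne (empty_mem_iff_bot.1 ?_)
  convert hk using 1
  ext x
  have : condProb μ (D k).σ (∅ : Set Ω) = 0 := by
    simp only [condProb, indicator_empty]
    exact condExp_zero
  simp only [this]
  norm_num

/-- Lévy's upward theorem: the conditional probabilities of `B` converge to its indicator almost
everywhere. Their superlevel sets are measurable at level `k`, so `ae_mem` puts them into the
filters; the thresholds `1 - 1 / (j + 1)` keep the exceptions countable in number. -/
lemma ae_isLimitDensityPoint [IsFiniteMeasure μ] {D : ℕ → DensitySystem μ} (hD : Monotone D)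
    {B : Set Ω} (hB : MeasurableSet[⨆ n, (D n).σ] B) :
    ∀ᵐ ω ∂μ, ω ∈ B → IsLimitDensityPoint D B ω := by
  let ℱ : Filtration ℕ mΩ := ⟨fun n => (D n).σ, fun _ _ h => (hD h).1, fun n => (D n).le⟩
  have h1 := tendsto_ae_condExp (μ := μ) (ℱ := ℱ) (B.indicator fun _ => (1 : ℝ))
  have h2 : μ[B.indicator (fun _ => (1 : ℝ)) | ⨆ n, ℱ n] = B.indicator fun _ => (1 : ℝ) :=
    condProb_of_measurableSet (iSup_le fun n => (D n).le) hB
  have h3 : ∀ᵐ ω ∂μ, ∀ (k j : ℕ), 1 - 1 / ((j : ℝ) + 1) < condProb μ (D k).σ B ω →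
      {x | 1 - 1 / ((j : ℝ) + 1) < condProb μ (D k).σ B x} ∈ (D k).filter ω := by
    refine ae_all_iff.2 fun k => ae_all_iff.2 fun j => (D k).ae_mem _ ?_
    exact stronglyMeasurable_condExp.measurable measurableSet_Ioi
  filter_upwards [h1, h3] with ω h1 h3 hω ε hε
  obtain ⟨j, hj⟩ := exists_nat_one_div_lt hε
  rw [h2, indicator_of_mem hω] at h1
  have : (1 : ℝ) - 1 / ((j : ℝ) + 1) < 1 := by
    have : 0 < 1 / ((j : ℝ) + 1) := Nat.one_div_pos_of_nat
    linarith
  filter_upwards [h1.eventually (lt_mem_nhds this)] with k hk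
  filter_upwards [h3 k j hk] with x hx
  have hx' : 1 - 1 / ((j : ℝ) + 1) < condProb μ (D k).σ B x := hx
  change 1 - ε < condProb μ (D k).σ B x
  linarith

/-- The union of the σ-algebras need not be a σ-algebra, so new sets appear in the limit. Their
filters consist of the sets essentially containing a measurable set that has `ω` as limit density
point. -/
lemma exists_ge_of_monotone [IsFiniteMeasure μ] {D : ℕ → DensitySystem μ} (hD : Monotone D) :
    ∃ D' : DensitySystem μ, ∀ n, D n ≤ D' := by
  have hle : (⨆ n, (D n).σ) ≤ mΩ := iSup_le fun n => (D n).le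
  have hn : ∀ n, (D n).σ ≤ ⨆ n, (D n).σ := le_iSup fun n => (D n).σ
  refine ⟨⟨⨆ n, (D n).σ, hle, fun ω =>
    { sets := {S | ∃ B, MeasurableSet[⨆ n, (D n).σ] B ∧ B ≤ᵐ[μ] S ∧ IsLimitDensityPoint D B ω}
      univ_sets := ⟨univ, MeasurableSet.univ, EventuallyLE.refl _ _,
        isLimitDensityPoint_of_mem hD (n := 0) MeasurableSet.univ univ_mem⟩
      sets_of_superset := ?_
      inter_sets := ?_ }, ?_, ?_, ?_, ?_⟩, fun n => ⟨hn n, ?_⟩⟩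
  · rintro S S' ⟨B, hB, hBS, h⟩ hS
    refine ⟨B, hB, ?_, h⟩
    filter_upwards [hBS] with x hx hxB using hS (hx hxB)
  · rintro S S' ⟨B, hB, hBS, h⟩ ⟨B', hB', hBS', h'⟩
    refine ⟨B ∩ B', hB.inter hB', ?_, h.inter h' (hle _ hB) (hle _ hB')⟩
    filter_upwards [hBS, hBS'] with x hx hx' hxB using ⟨hx hxB.1, hx' hxB.2⟩
  · intro ω
    refine ⟨fun hbot => ?_⟩
    obtain ⟨B, hB, hBS, h⟩ := empty_mem_iff_bot.2 hbot
    exact not_isLimitDensityPoint_empty (h.mono (hle _ hB) MeasurableSet.empty hBS)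
  · intro ω S hS
    refine ⟨univ, MeasurableSet.univ, ?_,
      isLimitDensityPoint_of_mem hD (n := 0) MeasurableSet.univ univ_mem⟩
    filter_upwards [hS] with x hx _ using hx
  · rintro ω S ⟨B, hB, hBS, h⟩
    exact ⟨B, hB, ⟨B, hB, EventuallyLE.refl _ _, h⟩, hBS⟩
  · intro B hB
    filter_upwards [ae_isLimitDensityPoint hD hB] with ω h hω
    exact ⟨B, hB, EventuallyLE.refl _ _, h hω⟩
  · intro ω S hS
    obtain ⟨B, hB, hBω, hBS⟩ := (D n).exists_measurable ω S hS
    exact ⟨B, hn n _ hB, hBS, isLimitDensityPoint_of_mem hD hB hBω⟩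

/-! ### Upper bounds of chains and the maximal system. -/

/-- Countably many sets from the union of the σ-algebras already lie in a single one, so the union
is a σ-algebra. The filters are directed, so a set in their infimum lies in one of them; no limit
argument is needed. -/
lemma exists_ge_of_countably_directed {c : Set (DensitySystem μ)} (hne : c.Nonempty)
    (hc : ∀ s : ℕ → DensitySystem μ, (∀ n, s n ∈ c) → ∃ D ∈ c, ∀ n, s n ≤ D) : BddAbove c := by
  have hne' : Nonempty c := hne.to_subtype
  obtain ⟨D₀, hD₀⟩ := hne
  have hdir : ∀ ω, Directed (· ≥ ·) fun D : c => (D : DensitySystem μ).filter ω := by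
    intro ω D D'
    obtain ⟨U, hU, h⟩ := hc (fun n => if n = 0 then (D : DensitySystem μ) else D')
      (fun n => by split_ifs; exacts [D.2, D'.2])
    exact ⟨⟨U, hU⟩, by simpa using (h 0).2 ω, by simpa using (h 1).2 ω⟩
  let m : MeasurableSpace Ω :=
    { MeasurableSet' := fun S => ∃ D ∈ c, MeasurableSet[D.σ] S
      measurableSet_empty := ⟨D₀, hD₀, @MeasurableSet.empty Ω D₀.σ⟩
      measurableSet_compl := fun S ⟨D, hD, hS⟩ => ⟨D, hD, hS.compl⟩
      measurableSet_iUnion := by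
        intro S hS
        choose D hD hS using hS
        obtain ⟨U, hU, h⟩ := hc D hD
        exact ⟨U, hU, MeasurableSet.iUnion fun n => (h n).1 _ (hS n)⟩ }
  refine ⟨⟨m, fun S ⟨D, _, hS⟩ => D.le S hS, fun ω => ⨅ D : c, (D : DensitySystem μ).filter ω,
    fun ω => ?_, fun ω => (iInf_le _ ⟨D₀, hD₀⟩).trans (D₀.le_ae ω), fun ω S hS => ?_, ?_⟩,
    fun D hD => ⟨fun S hS => ⟨D, hD, hS⟩, fun ω => iInf_le _ (⟨D, hD⟩ : c)⟩⟩
  · have : Nonempty Ω := ⟨ω⟩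
    exact iInf_neBot_of_directed (hdir ω) fun D => (D : DensitySystem μ).neBot ω
  · obtain ⟨D, hD⟩ := (mem_iInf_of_directed (hdir ω) S).1 hS
    obtain ⟨B, hB, hBω, hBS⟩ := (D : DensitySystem μ).exists_measurable ω S hD
    exact ⟨B, ⟨D, D.2, hB⟩, mem_iInf_of_mem D hBω, hBS⟩
  · rintro B ⟨D, hD, hB⟩
    filter_upwards [D.ae_mem B hB] with ω h hω
    exact mem_iInf_of_mem (⟨D, hD⟩ : c) (h hω)

/-- Either the chain has a countable cofinal sequence, made increasing by successive upper bounds,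
or every sequence in it has an upper bound within the chain. -/
lemma bddAbove_of_isChain [IsFiniteMeasure μ] {c : Set (DensitySystem μ)}
    (hc : IsChain (· ≤ ·) c) (hne : c.Nonempty) : BddAbove c := by
  by_cases h : ∃ s : ℕ → DensitySystem μ, (∀ n, s n ∈ c) ∧ ∀ D ∈ c, ∃ n, D ≤ s n
  · obtain ⟨s, hs, hcof⟩ := h
    have hub : ∀ D D' : c, ∃ U : c, (D : DensitySystem μ) ≤ U ∧ (D' : DensitySystem μ) ≤ U := by
      intro D D'
      rcases hc.total D.2 D'.2 with h | h
      · exact ⟨D', h, le_rfl⟩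
      · exact ⟨D, le_rfl, h⟩
    choose U hU hU' using hub
    let t : ℕ → c := fun n =>
      Nat.rec (motive := fun _ => c) ⟨s 0, hs 0⟩ (fun n D => U D ⟨s (n + 1), hs (n + 1)⟩) n
    have ht : Monotone fun n => (t n).1 :=
      monotone_nat_of_le_succ (f := fun n => (t n).1)
        fun n => hU (t n) ⟨s (n + 1), hs (n + 1)⟩
    have hst : ∀ n, s n ≤ t n := by
      rintro (_ | n)
      · exact le_rfl
      · exact hU' (t n) ⟨s (n + 1), hs (n + 1)⟩
    obtain ⟨D', hD'⟩ := exists_ge_of_monotone ht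
    refine ⟨D', fun D hD => ?_⟩
    obtain ⟨n, hn⟩ := hcof D hD
    exact (hn.trans (hst n)).trans (hD' n)
  · push Not at h
    refine exists_ge_of_countably_directed hne fun s hs => ?_
    obtain ⟨D, hD, h⟩ := h s hs
    exact ⟨D, hD, fun n => (hc.total hD (hs n)).resolve_left (h n)⟩

/-- A finite measure has a family of filters which represents every measurable set. -/
theorem exists_filter [IsFiniteMeasure μ] [NeZero μ] : ∃ f : Ω → Filter Ω,
    (∀ ω, (f ω).NeBot) ∧ (∀ ω, f ω ≤ ae μ) ∧
      ∀ B, MeasurableSet B → ∀ᵐ ω ∂μ, ω ∈ B → B ∈ f ω := by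
  have : Nonempty (DensitySystem μ) := ⟨trivial⟩
  obtain ⟨D, hD⟩ := zorn_le_nonempty (α := DensitySystem μ)
    fun c hc hne => bddAbove_of_isChain hc hne
  refine ⟨D.filter, D.neBot, D.le_ae, fun B hB => D.ae_mem B ?_⟩
  obtain ⟨D', hDD', hB'⟩ := D.exists_adjoin hB
  exact (hD hDD').1 _ hB'

end DensitySystem

end DensitySystems

/-! ### Pointwise bounds for local operators and the multiplier on a set of finite measure. -/

section LocalOperators

open Filter Set Topology

variable {𝕜 : Type*} [RCLike 𝕜] {Ω : Type*} {mΩ : MeasurableSpace Ω} {μ : Measure Ω}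
variable {E : Type*} [NormedAddCommGroup E] [NormedSpace 𝕜 E]
variable {F : Type*} [NormedAddCommGroup F] [NormedSpace 𝕜 F]
variable {p : ℝ≥0∞} [hp : Fact (1 ≤ p)]

lemma IsLocalOperator.ae_eq_on {T : Lp E p μ →L[𝕜] Lp E p μ} (hT : IsLocalOperator T)
    {f g : Lp E p μ} {B : Set Ω} (h : ∀ᵐ ω ∂μ, ω ∈ B → f ω = g ω) :
    ∀ᵐ ω ∂μ, ω ∈ B → T f ω = T g ω := by
  have h1 := hT (f - g)
  rw [map_sub] at h1
  filter_upwards [h, h1, Lp.coeFn_sub f g, Lp.coeFn_sub (T f) (T g)] with ω h h1 h2 h3 hω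
  rw [h2, h3] at h1
  exact sub_eq_zero.1 (h1 (sub_eq_zero.2 (h hω)))

/-- Testing `T` on `f` restricted to the bad set `C` gives `(‖T‖ * c + ε) * μ(C)^(1/p) ≤ ‖T‖ * c *
μ(C)^(1/p)`, which is impossible unless `C` is null. -/
lemma IsLocalOperator.norm_lt_add {T : Lp E p μ →L[𝕜] Lp E p μ} (hT : IsLocalOperator T)
    {f : Lp E p μ} {B : Set Ω} (hB : MeasurableSet B) (hμB : μ B ≠ ∞) {c : ℝ} (hc : 0 ≤ c)
    (h : ∀ᵐ ω ∂μ, ω ∈ B → ‖f ω‖ ≤ c) {ε : ℝ} (hε : 0 < ε) :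
    ∀ᵐ ω ∂μ, ω ∈ B → ‖T f ω‖ < ‖T‖ * c + ε := by
  have hp0 : p ≠ 0 := (zero_lt_one.trans_le hp.out).ne'
  set C : Set Ω := B ∩ {ω | ‖T‖ * c + ε ≤ ‖T f ω‖} with hC
  have hCm : MeasurableSet C :=
    hB.inter (measurableSet_le measurable_const (Lp.stronglyMeasurable (T f)).norm.measurable)
  have hCtop : μ C ≠ ∞ := ne_top_of_le_ne_top hμB (measure_mono inter_subset_left)
  suffices hC0 : μ C = 0 by
    filter_upwards [measure_eq_zero_iff_ae_notMem.1 hC0] with ω hω hωB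
    by_contra hlt
    exact hω ⟨hωB, not_lt.1 hlt⟩
  by_contra hC0
  let u : Lp E p μ := ((Lp.memLp f).indicator hCm).toLp _
  have hu : u =ᵐ[μ] C.indicator f := MemLp.coeFn_toLp _
  have huf : ∀ᵐ ω ∂μ, ω ∈ C → T u ω = T f ω := by
    refine hT.ae_eq_on ?_
    filter_upwards [hu] with ω hω hωC
    rw [hω, indicator_of_mem hωC]
  -- For `p = ∞` the exponent `1 / p.toReal` is `1 / 0 = 0` and the power is `1`, so this case needs
  -- no separate treatment.
  have hpos : 0 < μ.real C ^ (1 / p.toReal) :=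
    Real.rpow_pos_of_pos (ENNReal.toReal_pos hC0 hCtop) _
  have h1 : ‖u‖ ≤ c * μ.real C ^ (1 / p.toReal) := by
    have : ‖u‖ ≤ ‖indicatorConstLp p hCm hCtop c‖ := by
      refine Lp.norm_le_norm_of_ae_le ?_
      filter_upwards [hu, indicatorConstLp_coeFn (p := p) (hs := hCm) (hμs := hCtop) (c := c), h]
        with ω h1 h2 h3
      rw [h1, h2]
      by_cases hω : ω ∈ C
      · simpa [hω, abs_of_nonneg hc] using h3 hω.1
      · simp [hω]
    rwa [norm_indicatorConstLp' hp0 hC0, Real.norm_of_nonneg hc] at this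
  have hb : 0 ≤ ‖T‖ * c + ε := by positivity
  have h2 : (‖T‖ * c + ε) * μ.real C ^ (1 / p.toReal) ≤ ‖T u‖ := by
    have : ‖indicatorConstLp p hCm hCtop (‖T‖ * c + ε)‖ ≤ ‖T u‖ := by
      refine Lp.norm_le_norm_of_ae_le ?_
      filter_upwards [huf, indicatorConstLp_coeFn (p := p) (hs := hCm) (hμs := hCtop)
        (c := ‖T‖ * c + ε)] with ω h1 h2
      rw [h2]
      by_cases hω : ω ∈ C
      · rw [h1 hω, indicator_of_mem hω, Real.norm_of_nonneg hb]
        exact hω.2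
      · simp [hω]
    rwa [norm_indicatorConstLp' hp0 hC0, Real.norm_of_nonneg hb] at this
  have h3 := h2.trans ((T.le_opNorm u).trans (mul_le_mul_of_nonneg_left h1 (norm_nonneg T)))
  nlinarith [mul_pos hε hpos]

lemma IsLocalOperator.norm_le {T : Lp E p μ →L[𝕜] Lp E p μ} (hT : IsLocalOperator T)
    {f : Lp E p μ} {B : Set Ω} (hB : MeasurableSet B) (hμB : μ B ≠ ∞) {c : ℝ} (hc : 0 ≤ c)
    (h : ∀ᵐ ω ∂μ, ω ∈ B → ‖f ω‖ ≤ c) : ∀ᵐ ω ∂μ, ω ∈ B → ‖T f ω‖ ≤ ‖T‖ * c := by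
  have h1 : ∀ᵐ ω ∂μ, ∀ n : ℕ, ω ∈ B → ‖T f ω‖ < ‖T‖ * c + 1 / ((n : ℝ) + 1) :=
    ae_all_iff.2 fun n => hT.norm_lt_add hB hμB hc h Nat.one_div_pos_of_nat
  filter_upwards [h1] with ω hω hωB
  refine le_of_forall_pos_lt_add fun ε hε => ?_
  obtain ⟨n, hn⟩ := exists_nat_one_div_lt hε
  linarith [hω n hωB]

lemma IsLocalOperator.norm_sub_le {T : Lp E p μ →L[𝕜] Lp E p μ} (hT : IsLocalOperator T)
    {f g : Lp E p μ} {B : Set Ω} (hB : MeasurableSet B) (hμB : μ B ≠ ∞) {c : ℝ} (hc : 0 ≤ c)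
    (h : ∀ᵐ ω ∂μ, ω ∈ B → ‖f ω - g ω‖ ≤ c) :
    ∀ᵐ ω ∂μ, ω ∈ B → ‖T f ω - T g ω‖ ≤ ‖T‖ * c := by
  have h1 : ∀ᵐ ω ∂μ, ω ∈ B → ‖(f - g : Lp E p μ) ω‖ ≤ c := by
    filter_upwards [h, Lp.coeFn_sub f g] with ω h h2 hω
    rw [h2]
    exact h hω
  have h2 := hT.norm_le hB hμB hc h1
  rw [map_sub] at h2
  filter_upwards [h2, Lp.coeFn_sub (T f) (T g)] with ω h2 h3 hω
  have := h2 hω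
  rwa [h3] at this

/-- Pointwise weak-* limits along an ultrafilter of a family of asymptotically linear, bounded
maps. -/
lemma exists_weakStar_limit (U : Ultrafilter Ω) (Φ : E → Ω → StrongDual 𝕜 F) {C : ℝ} (hC : 0 ≤ C)
    (hadd : ∀ x y, ∀ᶠ ω in U, Φ (x + y) ω = Φ x ω + Φ y ω)
    (hsmul : ∀ (c : 𝕜) x, ∀ᶠ ω in U, Φ (c • x) ω = c • Φ x ω)
    (hb : ∀ x, ∀ᶠ ω in U, ‖Φ x ω‖ ≤ C * ‖x‖) :
    ∃ S : E →L[𝕜] StrongDual 𝕜 F, ‖S‖ ≤ C ∧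
      ∀ x y, Tendsto (fun ω => Φ x ω y) U (𝓝 (S x y)) := by
  have hlim : ∀ x y, ∃ l : 𝕜, ‖l‖ ≤ C * ‖x‖ * ‖y‖ ∧ Tendsto (fun ω => Φ x ω y) U (𝓝 l) := by
    intro x y
    have hmem : ∀ᶠ ω in U, Φ x ω y ∈ Metric.closedBall (0 : 𝕜) (C * ‖x‖ * ‖y‖) := by
      filter_upwards [hb x] with ω hω
      rw [mem_closedBall_zero_iff]
      exact (Φ x ω).le_of_opNorm_le hω y
    obtain ⟨l, hl, hl'⟩ := (isCompact_closedBall (0 : 𝕜) (C * ‖x‖ * ‖y‖)).ultrafilter_le_nhds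
      (U.map fun ω => Φ x ω y) (le_principal_iff.2 hmem)
    exact ⟨l, mem_closedBall_zero_iff.1 hl, hl'⟩
  choose l hl hlim using hlim
  let S : E →ₗ[𝕜] F →ₗ[𝕜] 𝕜 := LinearMap.mk₂ 𝕜 l
    (fun x x' y => by
      refine tendsto_nhds_unique (hlim (x + x') y) (((hlim x y).add (hlim x' y)).congr' ?_)
      filter_upwards [hadd x x'] with ω hω
      simp [hω])
    (fun c x y => by
      refine tendsto_nhds_unique (hlim (c • x) y) (((hlim x y).const_smul c).congr' ?_)
      filter_upwards [hsmul c x] with ω hω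
      simp [hω])
    (fun x y y' => by
      refine tendsto_nhds_unique (hlim x (y + y')) (((hlim x y).add (hlim x y')).congr fun ω => ?_)
      simp)
    (fun c x y => by
      refine tendsto_nhds_unique (hlim x (c • y)) (((hlim x y).const_smul c).congr fun ω => ?_)
      simp)
  exact ⟨S.mkContinuous₂ C hl, S.mkContinuous₂_norm_le hC _, hlim⟩

/-- Closed balls of the dual are weak-* closed. -/
lemma norm_le_of_tendsto_apply {U : Ultrafilter Ω} {g : Ω → StrongDual 𝕜 F} {s d : StrongDual 𝕜 F}
    (h : ∀ y, Tendsto (fun ω => g ω y) U (𝓝 (s y))) {c : ℝ} (hc : 0 ≤ c)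
    (hg : ∀ᶠ ω in U, ‖g ω - d‖ ≤ c) : ‖s - d‖ ≤ c := by
  refine ContinuousLinearMap.opNorm_le_bound _ hc fun y => ?_
  refine le_of_tendsto ((h y).sub_const (d y)).norm ?_
  filter_upwards [hg] with ω hω
  exact (g ω - d).le_of_opNorm_le hω y

/-- Weak-* limits along a representing family of filters recover strongly measurable functions. -/
lemma ae_eq_of_tendsto_apply {A : Set Ω} (hA : MeasurableSet A) {f : Ω → Filter Ω}
    (hf : ∀ B, MeasurableSet B → ∀ᵐ ω ∂(μ.restrict A), ω ∈ B → B ∈ f ω)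
    {U : Ω → Ultrafilter Ω} (hU : ∀ ω, (U ω : Filter Ω) ≤ f ω)
    {g s : Ω → StrongDual 𝕜 F} (hg : StronglyMeasurable g)
    (h : ∀ ω ∈ A, ∀ y, Tendsto (fun ω' => g ω' y) (U ω) (𝓝 (s ω y))) :
    ∀ᵐ ω ∂μ, ω ∈ A → s ω = g ω := by
  obtain ⟨c, hc, hgc⟩ := hg.isSeparable_range
  -- Only countably many small balls around points of `c` are used, so one null set serves for all
  -- approximations of `g ω`.
  have h1 : ∀ᵐ ω ∂(μ.restrict A), ∀ d ∈ c, ∀ n : ℕ, ‖g ω - d‖ ≤ 1 / ((n : ℝ) + 1) →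
      {ω' | ‖g ω' - d‖ ≤ 1 / ((n : ℝ) + 1)} ∈ f ω := by
    refine (ae_ball_iff hc).2 fun d _ => ae_all_iff.2 fun n => hf _ ?_
    exact measurableSet_le (hg.sub stronglyMeasurable_const).norm.measurable measurable_const
  rw [ae_restrict_iff' hA] at h1
  filter_upwards [h1] with ω h1 hω
  refine eq_of_forall_dist_le fun ε hε => ?_
  obtain ⟨n, hn⟩ := exists_nat_one_div_lt (half_pos hε)
  obtain ⟨d, hd, hgd⟩ := Metric.mem_closure_iff.1 (hgc (mem_range_self ω)) (1 / ((n : ℝ) + 1))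
    Nat.one_div_pos_of_nat
  have h2 : ‖s ω - d‖ ≤ 1 / ((n : ℝ) + 1) := norm_le_of_tendsto_apply (h ω hω)
    Nat.one_div_pos_of_nat.le (hU ω (h1 hω d hd n (by rw [← dist_eq_norm]; exact hgd.le)))
  rw [← dist_eq_norm] at h2
  have := dist_triangle_right (s ω) (g ω) d
  linarith

/-- The multiplier of a local operator on a set of finite measure. -/
lemma IsLocalOperator.exists_multiplier_on
    {T : Lp (StrongDual 𝕜 F) p μ →L[𝕜] Lp (StrongDual 𝕜 F) p μ} (hT : IsLocalOperator T)
    {A : Set Ω} (hA : MeasurableSet A) (hμA : μ A ≠ ∞) :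
    ∃ N : Ω → StrongDual 𝕜 F →L[𝕜] StrongDual 𝕜 F, (∀ ω, ‖N ω‖ ≤ ‖T‖) ∧
      ∀ x, ∀ᵐ ω ∂μ, ω ∈ A → N ω x = T (indicatorConstLp p hA hμA x) ω := by
  -- A null set carries no proper filter below `ae`.
  by_cases hA0 : μ A = 0
  · refine ⟨0, fun ω => by simp, fun x => ?_⟩
    filter_upwards [measure_eq_zero_iff_ae_notMem.1 hA0] with ω hω hω'
    exact absurd hω' hω
  have : IsFiniteMeasure (μ.restrict A) := isFiniteMeasure_restrict.2 hμA
  have : NeZero (μ.restrict A) := ⟨by simpa using hA0⟩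
  obtain ⟨f, hne, hae, hf⟩ := DensitySystem.exists_filter (μ := μ.restrict A)
  let U : Ω → Ultrafilter Ω := fun ω => Ultrafilter.of (f ω)
  have hU : ∀ ω, (U ω : Filter Ω) ≤ f ω := fun ω => Ultrafilter.of_le _
  have hUA : ∀ ω {P : Ω → Prop}, (∀ᵐ ω' ∂μ, ω' ∈ A → P ω') → ∀ᶠ ω' in U ω, P ω' :=
    fun ω P hP => hU ω (hae ω ((ae_restrict_iff' hA).2 hP))
  have hlim := fun ω => exists_weakStar_limit (U ω)
    (fun x => T (indicatorConstLp p hA hμA x)) (norm_nonneg T)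
    (fun x y => hUA ω <| by
      rw [← indicatorConstLp_add, map_add]
      filter_upwards [Lp.coeFn_add (T (indicatorConstLp p hA hμA x))
        (T (indicatorConstLp p hA hμA y))] with ω' h _ using h)
    (fun c x => hUA ω <| by
      have : indicatorConstLp p hA hμA (c • x) = c • indicatorConstLp p hA hμA x := by
        ext1
        filter_upwards [indicatorConstLp_coeFn (p := p) (hs := hA) (hμs := hμA) (c := c • x),
          indicatorConstLp_coeFn (p := p) (hs := hA) (hμs := hμA) (c := x),
          Lp.coeFn_smul c (indicatorConstLp p hA hμA x)] with ω' h1 h2 h3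
        rw [h1, h3, Pi.smul_apply, h2]
        by_cases hω : ω' ∈ A <;> simp [hω]
      rw [this, map_smul]
      filter_upwards [Lp.coeFn_smul c (T (indicatorConstLp p hA hμA x))] with ω' h _ using h)
    (fun x => hUA ω <| by
      refine hT.norm_le hA hμA (norm_nonneg x) ?_
      filter_upwards [indicatorConstLp_coeFn (p := p) (hs := hA) (hμs := hμA) (c := x)]
        with ω' h hω'
      rw [h, indicator_of_mem hω'])
  choose N hN hlim using hlim
  exact ⟨N, hN, fun x => ae_eq_of_tendsto_apply hA hf hU (Lp.stronglyMeasurable _)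
    fun ω _ y => hlim ω x y⟩

end LocalOperators

/-! ### Gluing over the partition and passing from constants to all functions. -/

section Gluing

open Filter Set Topology

variable {𝕜 : Type*} [RCLike 𝕜] {Ω : Type*} {mΩ : MeasurableSpace Ω} {μ : Measure Ω}
variable {F : Type*} [NormedAddCommGroup F] [NormedSpace 𝕜 F]
variable {p : ℝ≥0∞} [hp : Fact (1 ≤ p)]

/-- The partition may be uncountable, so null sets cannot simply be united. Completeness makes each
trace of the exceptional set measurable, hence the whole set, and the sum formula makes it null. -/
lemma ae_of_ae_mem_imp [μ.IsComplete] {𝒜 : Set (Set Ω)}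
    (hmeas : ∀ B : Set Ω, (∀ A ∈ 𝒜, MeasurableSet (B ∩ A)) → MeasurableSet B)
    (hsum : ∀ B : Set Ω, MeasurableSet B → μ B = ∑' A : 𝒜, μ (B ∩ (A : Set Ω)))
    {P : Ω → Prop} (h : ∀ A ∈ 𝒜, ∀ᵐ ω ∂μ, ω ∈ A → P ω) : ∀ᵐ ω ∂μ, P ω := by
  have h0 : ∀ A ∈ 𝒜, μ ({ω | ¬ P ω} ∩ A) = 0 := by
    intro A hA
    rw [measure_eq_zero_iff_ae_notMem]
    filter_upwards [h A hA] with ω hω hω'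
    exact hω'.1 (hω hω'.2)
  have hm : MeasurableSet {ω | ¬ P ω} :=
    hmeas _ fun A hA => Measure.IsComplete.out' _ (h0 A hA)
  rw [ae_iff, hsum _ hm]
  simp [h0]

lemma measurable_of_ae_eq_on [μ.IsComplete] {𝒜 : Set (Set Ω)}
    (h𝒜 : ∀ A ∈ 𝒜, MeasurableSet A)
    (hmeas : ∀ B : Set Ω, (∀ A ∈ 𝒜, MeasurableSet (B ∩ A)) → MeasurableSet B)
    {g : Ω → 𝕜} (h : ∀ A ∈ 𝒜, ∃ k : Ω → 𝕜, Measurable k ∧ ∀ᵐ ω ∂μ, ω ∈ A → g ω = k ω) :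
    Measurable g := by
  intro s hs
  refine hmeas _ fun A hA => ?_
  obtain ⟨k, hk, hgk⟩ := h A hA
  refine NullMeasurableSet.measurable_of_complete (μ := μ) ?_
  refine ((hk hs).inter (h𝒜 A hA)).nullMeasurableSet.congr ?_
  filter_upwards [hgk] with ω hω
  refine propext (and_congr_left fun hωA => ?_)
  change k ω ∈ s ↔ g ω ∈ s
  rw [hω hωA]

/-- Elements of the projective tensor product are norm limits of sequences of finite sums of
elementary tensors, and measurability survives pointwise limits. -/
lemma measurable_dualEquiv_apply {E : Type*} [NormedAddCommGroup E] [NormedSpace 𝕜 E]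
    {N : Ω → E →L[𝕜] StrongDual 𝕜 F} (h : ∀ x y, Measurable fun ω => N ω x y)
    (v : ProjTensor 𝕜 E F) : Measurable fun ω => ProjTensor.dualEquiv 𝕜 E F (N ω) v := by
  have key : ∀ u ∈ elemTensorSpan 𝕜 E F, Measurable fun ω => u (N ω) := by
    intro u hu
    induction hu using Submodule.span_induction with
    | mem t ht => obtain ⟨x, y, rfl⟩ := ht; exact h x y
    | zero => exact measurable_const
    | add a b _ _ iha ihb => exact iha.add ihb
    | smul c a _ iha => exact iha.const_mul c
  obtain ⟨u, hu⟩ := v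
  obtain ⟨s, hs, hlim⟩ := mem_closure_iff_seq_limit.1 hu
  refine measurable_of_tendsto_metrizable (fun n => key (s n) (hs n)) (tendsto_pi_nhds.2 fun ω => ?_)
  exact ((ContinuousLinearMap.apply 𝕜 𝕜 (N ω)).continuous.tendsto u).comp hlim

lemma exists_multiplier_of_partition
    {T : Lp (StrongDual 𝕜 F) p μ →L[𝕜] Lp (StrongDual 𝕜 F) p μ} (hT : IsLocalOperator T)
    {𝒜 : Set (Set Ω)} (h𝒜 : ∀ A ∈ 𝒜, MeasurableSet A ∧ μ A < ∞)
    (hdisj : 𝒜.PairwiseDisjoint id) :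
    ∃ N : Ω → StrongDual 𝕜 F →L[𝕜] StrongDual 𝕜 F, (∀ ω, ‖N ω‖ ≤ ‖T‖) ∧
      ∀ A (hA : A ∈ 𝒜) x, ∀ᵐ ω ∂μ, ω ∈ A →
        N ω x = T (indicatorConstLp p (h𝒜 A hA).1 (h𝒜 A hA).2.ne x) ω := by
  classical
  choose N hN hNT using fun A : 𝒜 =>
    hT.exists_multiplier_on (h𝒜 A A.2).1 (h𝒜 A A.2).2.ne
  refine ⟨fun ω => if h : ∃ A : 𝒜, ω ∈ (A : Set Ω) then N h.choose ω else 0, fun ω => ?_,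
    fun A hA x => ?_⟩
  · dsimp only
    split_ifs with h
    · exact hN _ _
    · simp
  · filter_upwards [hNT ⟨A, hA⟩ x] with ω hω hωA
    have h : ∃ A : 𝒜, ω ∈ (A : Set Ω) := ⟨⟨A, hA⟩, hωA⟩
    have hchoose : h.choose = ⟨A, hA⟩ :=
      Subtype.ext (hdisj.elim_set h.choose.2 hA ω h.choose_spec hωA)
    simp only [h, dif_pos, hchoose]
    exact hω hωA

/-- A field of operators of norm at most `‖T‖` that represents a local operator `T` on constants
represents it on all functions. -/
lemma IsLocalOperator.ae_eq_of_const {E : Type*} [NormedAddCommGroup E] [NormedSpace 𝕜 E]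
    {T : Lp E p μ →L[𝕜] Lp E p μ} (hT : IsLocalOperator T)
    {A : Set Ω} (hA : MeasurableSet A) (hμA : μ A ≠ ∞) {N : Ω → E →L[𝕜] E}
    (hN : ∀ ω, ‖N ω‖ ≤ ‖T‖)
    (h : ∀ x, ∀ᵐ ω ∂μ, ω ∈ A → N ω x = T (indicatorConstLp p hA hμA x) ω) (f : Lp E p μ) :
    ∀ᵐ ω ∂μ, ω ∈ A → N ω (f ω) = T f ω := by
  obtain ⟨c, hc, hfc⟩ := (Lp.stronglyMeasurable f).isSeparable_range
  have h1 : ∀ᵐ ω ∂μ, ∀ x ∈ c, ω ∈ A → N ω x = T (indicatorConstLp p hA hμA x) ω :=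
    (ae_ball_iff hc).2 fun x _ => h x
  -- The approximant `x` of `f ω` will depend on `ω`, so the local bound for `f - 1_A x` is secured
  -- beforehand for all `x ∈ c` and all `n`.
  have h2 : ∀ᵐ ω ∂μ, ∀ x ∈ c, ∀ n : ℕ, ω ∈ A ∩ {ω | ‖f ω - x‖ ≤ 1 / ((n : ℝ) + 1)} →
      ‖T f ω - T (indicatorConstLp p hA hμA x) ω‖ ≤ ‖T‖ * (1 / ((n : ℝ) + 1)) := by
    refine (ae_ball_iff hc).2 fun x _ => ae_all_iff.2 fun n => ?_
    refine hT.norm_sub_le (hA.inter (measurableSet_le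
      ((Lp.stronglyMeasurable f).sub stronglyMeasurable_const).norm.measurable measurable_const))
      (ne_top_of_le_ne_top hμA (measure_mono inter_subset_left)) Nat.one_div_pos_of_nat.le ?_
    filter_upwards [indicatorConstLp_coeFn (p := p) (hs := hA) (hμs := hμA) (c := x)]
      with ω hω hωA
    rw [hω, indicator_of_mem hωA.1]
    exact hωA.2
  filter_upwards [h1, h2] with ω h1 h2 hω
  have h3 : ∀ n : ℕ, dist (N ω (f ω)) (T f ω) ≤ 2 * ‖T‖ * (1 / ((n : ℝ) + 1)) := by
    intro n
    obtain ⟨x, hx, hfx⟩ := Metric.mem_closure_iff.1 (hfc (mem_range_self ω)) (1 / ((n : ℝ) + 1))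
      Nat.one_div_pos_of_nat
    have h4 := h2 x hx n ⟨hω, by rw [mem_ofPred_eq, ← dist_eq_norm]; exact hfx.le⟩
    have h5 : dist (N ω (f ω)) (N ω x) ≤ ‖T‖ * (1 / ((n : ℝ) + 1)) := by
      rw [dist_eq_norm, ← map_sub]
      refine ((N ω).le_of_opNorm_le (hN ω) _).trans ?_
      rw [← dist_eq_norm]
      gcongr
    rw [← h1 x hx hω, ← dist_eq_norm] at h4
    have := dist_triangle_right (N ω (f ω)) (T f ω) (N ω x)
    linarith
  have h6 : Tendsto (fun n : ℕ => 2 * ‖T‖ * (1 / ((n : ℝ) + 1))) atTop (𝓝 (2 * ‖T‖ * 0)) :=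
    tendsto_one_div_add_atTop_nhds_zero_nat.const_mul _
  rw [mul_zero] at h6
  exact dist_le_zero.1 (ge_of_tendsto' h6 h3)

lemma sigmaStarNorm_lt_top_of_norm_le {X : Type*} [NormedAddCommGroup X] [NormedSpace 𝕜 X]
    {G : Type*} [NormedAddCommGroup G] [NormedSpace 𝕜 G] (J : X ≃ₗᵢ[𝕜] StrongDual 𝕜 G)
    {N : Ω → X} {C : ℝ} (hN : ∀ ω, ‖N ω‖ ≤ C) : sigmaStarNorm J μ N < ∞ := by
  refine lt_of_le_of_lt (iSup₂_le fun v hv => ?_) (ENNReal.ofReal_lt_top (r := C))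
  refine essSup_le_of_ae_le _ (Eventually.of_forall fun ω => ?_)
  dsimp only
  rw [← ofReal_norm]
  refine ENNReal.ofReal_le_ofReal ?_
  have h1 : ‖J (N ω) v‖ ≤ C * ‖v‖ :=
    (J (N ω)).le_of_opNorm_le (by rw [J.norm_map]; exact hN ω) v
  have hv1 : ‖v‖ ≤ 1 := mem_closedBall_zero_iff.1 hv
  exact h1.trans (mul_le_of_le_one_right ((norm_nonneg _).trans (hN ω)) hv1)

/-- Functions of vanishing `σ*`-seminorm vanish almost everywhere against each element of the
predual. -/
lemma ae_apply_eq_zero_of_sigmaStarNorm_eq_zero {X : Type*} [NormedAddCommGroup X]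
    [NormedSpace 𝕜 X] {G : Type*} [NormedAddCommGroup G] [NormedSpace 𝕜 G]
    {J : X ≃ₗᵢ[𝕜] StrongDual 𝕜 G} {N : Ω → X} (hN : sigmaStarNorm J μ N = 0) (v : G) :
    ∀ᵐ ω ∂μ, J (N ω) v = 0 := by
  have hball : ∀ u ∈ Metric.closedBall (0 : G) 1, ∀ᵐ ω ∂μ, J (N ω) u = 0 := by
    intro u hu
    have h0 : essSup (fun ω => ‖J (N ω) u‖ₑ) μ = 0 := by
      refine le_antisymm ?_ bot_le
      rw [← hN]
      exact le_iSup₂ (f := fun v _ => essSup (fun ω => ‖J (N ω) v‖ₑ) μ) u hu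
    filter_upwards [ENNReal.essSup_eq_zero_iff.1 h0] with ω hω
    simpa using hω
  obtain ⟨c, hc0, hc⟩ : ∃ c : 𝕜, c ≠ 0 ∧ ‖c • v‖ ≤ 1 := by
    refine ⟨((‖v‖ + 1)⁻¹ : ℝ), ?_, ?_⟩
    · exact_mod_cast (by positivity : (‖v‖ + 1)⁻¹ ≠ 0)
    · rw [norm_smul, RCLike.norm_ofReal, abs_of_nonneg (by positivity), inv_mul_le_one₀]
      · linarith
      · positivity
  filter_upwards [hball (c • v) (mem_closedBall_zero_iff.2 hc)] with ω hω
  rw [map_smul, smul_eq_zero] at hω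
  exact hω.resolve_left hc0

end Gluing

end

/-! ### The representation theorem. -/

theorem mainTheorem3 {𝕜 : Type*} [RCLike 𝕜] {Ω : Type*} [MeasurableSpace Ω]
    (μ : Measure Ω) [μ.IsComplete] (hμ : IsStrictlyLocalizable μ)
    {F : Type*} [NormedAddCommGroup F] [NormedSpace 𝕜 F] [CompleteSpace F]
    (p : ℝ≥0∞) [Fact (1 ≤ p)]
    (T : Lp (StrongDual 𝕜 F) p μ →L[𝕜] Lp (StrongDual 𝕜 F) p μ) (hT : IsLocalOperator T) :
    ∃ M : Multipliers 𝕜 F μ, IsMultiplicationBy M T := by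
  obtain ⟨𝒜, h𝒜, hdisj, -, hmeas, hsum⟩ := hμ
  obtain ⟨N, hN, hNT⟩ := exists_multiplier_of_partition hT h𝒜 hdisj
  have hstrong : ∀ f : Lp (StrongDual 𝕜 F) p μ, ∀ᵐ ω ∂μ, N ω (f ω) = T f ω := fun f =>
    ae_of_ae_mem_imp hmeas hsum fun A hA =>
      hT.ae_eq_of_const (h𝒜 A hA).1 (h𝒜 A hA).2.ne hN (hNT A hA) f
  have hNm : ∀ x y, Measurable fun ω => N ω x y := fun x y =>
    measurable_of_ae_eq_on (fun A hA => (h𝒜 A hA).1) hmeas fun A hA =>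
      ⟨fun ω => T (indicatorConstLp p (h𝒜 A hA).1 (h𝒜 A hA).2.ne x) ω y,
        ((ContinuousLinearMap.apply 𝕜 𝕜 y).continuous.comp_stronglyMeasurable
          (Lp.stronglyMeasurable _)).measurable, by
        filter_upwards [hNT A hA x] with ω hω hωA
        rw [hω hωA]⟩
  let N₀ : LSigmaStarFun (ProjTensor.dualEquiv 𝕜 (StrongDual 𝕜 F) F) μ :=
    ⟨N, measurable_dualEquiv_apply hNm, sigmaStarNorm_lt_top_of_norm_le _ hN⟩
  refine ⟨Submodule.Quotient.mk N₀, ⟨fun N' hN' f v => ?_, N₀, rfl, hstrong⟩⟩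
  have hnull := (Submodule.Quotient.eq _).1 hN'
  obtain ⟨c, hc, hfc⟩ := (Lp.stronglyMeasurable f).isSeparable_range
  -- `N' - N` vanishes almost everywhere against each `x ⊗ v`. Countably many `x`, with closure
  -- containing the range of `f`, suffice by continuity of both operators.
  have h1 : ∀ᵐ ω ∂μ, ∀ x ∈ c, (N' : Ω → StrongDual 𝕜 F →L[𝕜] StrongDual 𝕜 F) ω x v = N ω x v := by
    refine (ae_ball_iff hc).2 fun x _ => ?_
    filter_upwards [ae_apply_eq_zero_of_sigmaStarNorm_eq_zero hnull (ProjTensor.tmul x v)]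
      with ω hω
    rw [ProjTensor.dualEquiv_tmul] at hω
    exact sub_eq_zero.1 hω
  filter_upwards [h1, hstrong f] with ω h1 h2
  rw [← h2]
  have hclosed : IsClosed {x | (N' : Ω → StrongDual 𝕜 F →L[𝕜] StrongDual 𝕜 F) ω x v = N ω x v} :=
    isClosed_eq (by fun_prop) (by fun_prop)
  exact closure_minimal h1 hclosed (hfc (Set.mem_range_self ω))
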